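/- Let $M$ be a smooth ($C^\infty$) compact connected manifold without boundary, of dimension at least $2$, with a distance $d$ that induces its topology, and let $m$ be a smooth volume measure on $M$, i.e. a Borel measure given in every smooth chart by a positive $C^\infty$ density with respect to Lebesgue measure. Fix an integer $r\ge 0$. Let $\mathrm{Diff}^r_m(M)$ be the space of $C^r$ diffeomorphisms of $M$ (homeomorphisms, if $r=0$) that preserve $m$. For $r\ge 1$ it carries the $C^r$ topology, and for $r=0$ the topology in which $f_n\to f$ if and only if $f_n\to f$ and $f_n^{-1}\to f^{-1}$ uniformly. For $\eta>0$ and $\Lambda\subset M$ let $B_\eta(\Lambda)=\{y\in M : d(y,x)<\eta \text{ for some } x\in\Lambda\}$. Then there is a residual set $\mathcal R\subset \mathrm{Diff}^r_m(M)$ (that is, a set containing a countable intersection of open dense subsets) such that for every $f\in\mathcal R$, every Borel set $\Lambda\subset M$ with $f(\Lambda)=\Lambda$, and every $\eta>0$ there is a neighbourhood $\mathcal V$ of $f$ in $\mathrm{Diff}^r_m(M)$ such that for every $g\in\mathcal V$ there exists a Borel set $\tilde\Lambda\subset M$ with $g(\tilde\Lambda)=\tilde\Lambda$, $$\tilde\Lambda\subset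 B_\eta(\Lambda)\quad\text{and}\quad m(\tilde\Lambda\mathbin{\triangle}\Lambda)<\eta .$$ -/

import Mathlib

open Set Filter Topology MeasureTheory
open scoped Manifold ContDiff

/-- A smooth (positive) volume measure on a smooth manifold `M` of dimension `d`: in every smooth
chart `φ` it is given by a positive `C^∞` density `ρ` with respect to Lebesgue measure on
`ℝ^d`, that is, `m A = ∫_{φ(A)} ρ` for every Borel subset `A` of the domain of `φ`. -/
def IsSmoothVolume (d : ℕ) {M : Type*} [TopologicalSpace M]
    [ChartedSpace (EuclideanSpace ℝ (Fin d)) M] [MeasurableSpace M] (m : Measure M) : Prop :=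
  ∀ φ ∈ IsManifold.maximalAtlas (𝓡 d) ∞ M, ∃ ρ : EuclideanSpace ℝ (Fin d) → ℝ,
    ContDiffOn ℝ ∞ ρ φ.target ∧ (∀ y ∈ φ.target, 0 < ρ y) ∧
      ∀ A : Set M, MeasurableSet A → A ⊆ φ.source →
        m A = ∫⁻ y in φ '' A, ENNReal.ofReal (ρ y)

/-- `C^r` diffeomorphisms of `M`, for an integer `r ≥ 0`. A `C^0` map is a continuous map,
so that for `r = 0` these are the homeomorphisms of `M`. -/
abbrev CrDiff (d r : ℕ) (M : Type*) [TopologicalSpace M]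
    [ChartedSpace (EuclideanSpace ℝ (Fin d)) M] : Type _ :=
  M ≃ₘ^(r : ℕ∞ω)⟮𝓡 d, 𝓡 d⟯ M

/-- The basic `C^r` neighbourhood of `f` determined by two smooth charts `φ`, `ψ`, a compact
set `K` in the domain of `φ`, with image under `f` in the domain of `ψ`, and a number `ε`: the set
of all `g` that map `K` into the domain of `ψ` and for which, in these charts, all partial
derivatives of order at most `r` of `g` are `ε`-close to those of `f` at the points of `K`. -/
def crNhd {d r : ℕ} {M : Type*} [TopologicalSpace M]
    [ChartedSpace (EuclideanSpace ℝ (Fin d)) M] (f : CrDiff d r M)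
    (φ ψ : OpenPartialHomeomorph M (EuclideanSpace ℝ (Fin d))) (K : Set M) (ε : ℝ) :
    Set (CrDiff d r M) :=
  {g | MapsTo g K ψ.source ∧ ∀ k ≤ r, ∀ x ∈ K,
    ‖iteratedFDeriv ℝ k (ψ ∘ g ∘ φ.symm) (φ x) -
      iteratedFDeriv ℝ k (ψ ∘ f ∘ φ.symm) (φ x)‖ < ε}

/-- The topology of `Diff^r(M)`. For `r = 0` it is the topology of uniform convergence of `f` and
of its inverse (on a compact space the compact-open topology of `C(M, M)` is the
topology of uniform convergence). For `r ≥ 1` it is the usual `C^r` topology,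
generated by the basic `C^r` neighbourhoods. -/
noncomputable instance crTopology (d r : ℕ) (M : Type*) [TopologicalSpace M]
    [ChartedSpace (EuclideanSpace ℝ (Fin d)) M] : TopologicalSpace (CrDiff d r M) :=
  if r = 0 then
    TopologicalSpace.induced
      (fun f : CrDiff d r M =>
        ((⟨f, f.continuous⟩, ⟨f.symm, f.symm.continuous⟩) : C(M, M) × C(M, M)))
      inferInstance
  else
    TopologicalSpace.generateFrom
      {S | ∃ (f : CrDiff d r M) (φ ψ : OpenPartialHomeomorph M (EuclideanSpace ℝ (Fin d)))
          (K : Set M) (ε : ℝ),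
        φ ∈ IsManifold.maximalAtlas (𝓡 d) ∞ M ∧ ψ ∈ IsManifold.maximalAtlas (𝓡 d) ∞ M ∧
        IsCompact K ∧ K ⊆ φ.source ∧ MapsTo f K ψ.source ∧ 0 < ε ∧ S = crNhd f φ ψ K ε}

/-- `Diff^r_m(M)`: the `C^r` diffeomorphisms that preserve the measure `m`, with the topology
induced from `Diff^r(M)`. -/
abbrev VolDiff (d r : ℕ) {M : Type*} [TopologicalSpace M]
    [ChartedSpace (EuclideanSpace ℝ (Fin d)) M] [MeasurableSpace M] (m : Measure M) : Type _ :=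
  {f : CrDiff d r M // MeasurePreserving f m m}

/-! An invariant set `Λ` of `f` gives a fixed vector `1_Λ` of the Koopman isometry of `f` on
`L²(m)`. Let `P_f` be the projection onto the fixed vectors. By the mean ergodic theorem `‖P_f v‖`
is an infimum of norms of Birkhoff averages, each continuous in `f`; so it is upper semicontinuous,
hence continuous at generic `f`, and Pythagoras upgrades this to continuity of `P_f v`
(`eventually_residual_continuousAt_fixedProj`). For `g` near such an `f`, `P_g 1_Λ` is close to
`1_Λ`, and its superlevel set at `1/2` is the invariant set sought, up to null sets.

To stay in the `η`-neighbourhood of `Λ`, cover its complement by a finite union `O` of basic open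
sets missing the closure of `Λ`, and discard the points whose forward `g`-orbit meets `O`. These
form an open set whose measure is lower semicontinuous in `g`, so generically continuous; for `f` it
misses `Λ`, so little of `Λ` is lost. -/

/-- An upper semicontinuous real function on an arbitrary topological space is continuous at the
points of a residual set. -/
theorem UpperSemicontinuous.eventually_residual_continuousAt {X : Type*} [TopologicalSpace X]
    {h : X → ℝ} (hh : UpperSemicontinuous h) : ∀ᶠ x in residual X, ContinuousAt h x := by
  -- A failure of lower semicontinuity at a point puts it on the frontier of some rational sublevel
  -- set; these are open, so their frontiers are nowhere dense.
  have key : ∀ q : ℚ, ∀ᶠ x in residual X, x ∉ frontier (h ⁻¹' Iio (q : ℝ)) := by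
    intro q
    have ho : IsOpen (h ⁻¹' Iio (q : ℝ)) := hh.isOpen_preimage q
    refine residual_of_dense_open isClosed_frontier.isOpen_compl ?_
    exact interior_eq_empty_iff_dense_compl.1 (interior_frontier ho.isClosed_compl |> fun h => by
      rwa [frontier_compl] at h)
  filter_upwards [eventually_countable_forall.2 key] with x hx
  refine continuousAt_iff_lower_upperSemicontinuousAt.2 ⟨fun a ha => ?_, hh x⟩
  obtain ⟨q, haq, hqx⟩ := exists_rat_btwn ha
  have hxq : x ∉ closure (h ⁻¹' Iio (q : ℝ)) := by
    intro hc
    refine hx q ⟨hc, ?_⟩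
    rw [(hh.isOpen_preimage q).interior_eq]
    exact fun h => lt_asymm h hqx
  filter_upwards [isClosed_closure.isOpen_compl.mem_nhds hxq] with y hy
  exact haq.trans_le (not_lt.1 fun h => hy (subset_closure h))

theorem continuous_birkhoffAverage_of_continuous {H X : Type*} [NormedAddCommGroup H]
    [InnerProductSpace ℝ H] [TopologicalSpace X] {U : X → H →ₗᵢ[ℝ] H}
    (hU : Continuous fun p : X × H => U p.1 p.2) (n : ℕ) (v : H) : Continuous fun x => birkhoffAverage ℝ (U x) id n v := by
  have hk : ∀ k : ℕ, Continuous fun x => (U x)^[k] v := by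
    intro k
    induction k with
    | zero => exact continuous_const
    | succ k ih =>
      simp only [Function.iterate_succ_apply']
      exact hU.comp (continuous_id.prodMk ih)
  simp only [birkhoffAverage, birkhoffSum, id]
  exact (continuous_finsetSum _ fun k _ => hk k).const_smul _

/-! ### Mean ergodic projections depending on a parameter -/

section MeanErgodic

variable {H : Type*} [NormedAddCommGroup H] [InnerProductSpace ℝ H] [CompleteSpace H]

/-- The orthogonal projection onto the space of fixed vectors of a linear isometry. -/
noncomputable def LinearIsometry.fixedProj (U : H →ₗᵢ[ℝ] H) : H →L[ℝ] H :=
  (U.toContinuousLinearMap.eqLocus (1 : H →L[ℝ] H)).starProjection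

theorem LinearIsometry.map_fixedProj (U : H →ₗᵢ[ℝ] H) (v : H) :
    U (U.fixedProj v) = U.fixedProj v :=
  (U.toContinuousLinearMap.eqLocus (1 : H →L[ℝ] H)).starProjection_apply_mem v

theorem LinearIsometry.fixedProj_of_fixed (U : H →ₗᵢ[ℝ] H) {v : H} (hv : U v = v) :
    U.fixedProj v = v :=
  Submodule.starProjection_eq_self_iff.2 hv

theorem LinearIsometry.norm_fixedProj_le (U : H →ₗᵢ[ℝ] H) (v : H) : ‖U.fixedProj v‖ ≤ ‖v‖ :=
  Submodule.norm_starProjection_apply_le _ v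

/-- `U v - v` is orthogonal to every fixed `z`, because `⟪z, U v⟫ = ⟪U z, U v⟫ = ⟪z, v⟫`. -/
theorem LinearIsometry.fixedProj_map (U : H →ₗᵢ[ℝ] H) (v : H) :
    U.fixedProj (U v) = U.fixedProj v := by
  rw [← sub_eq_zero, ← map_sub]
  refine (Submodule.starProjection_apply_eq_zero_iff _).2 ?_
  intro z hz
  have hz' : U z = z := hz
  rw [inner_sub_right, sub_eq_zero]
  conv_lhs => rw [← hz']
  exact U.inner_map_map z v

theorem LinearIsometry.fixedProj_birkhoffAverage (U : H →ₗᵢ[ℝ] H) (v : H) {n : ℕ} (hn : n ≠ 0) :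
    U.fixedProj (birkhoffAverage ℝ U _root_.id n v) = U.fixedProj v := by
  have hk : ∀ k, U.fixedProj (U^[k] v) = U.fixedProj v := by
    intro k
    induction k with
    | zero => rfl
    | succ k ih => rw [Function.iterate_succ_apply', U.fixedProj_map, ih]
  simp only [birkhoffAverage, birkhoffSum, _root_.id, map_smul, map_sum, hk, Finset.sum_const,
    Finset.card_range]
  rw [← Nat.cast_smul_eq_nsmul ℝ, smul_smul, inv_mul_cancel₀ (by exact_mod_cast hn), one_smul]

theorem LinearIsometry.tendsto_birkhoffAverage_fixedProj (U : H →ₗᵢ[ℝ] H) (v : H) :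
    Tendsto (birkhoffAverage ℝ U _root_.id · v) atTop (𝓝 (U.fixedProj v)) :=
  U.toContinuousLinearMap.tendsto_birkhoffAverage_orthogonalProjection
    U.norm_toContinuousLinearMap_le v

theorem LinearIsometry.norm_birkhoffAverage_sub_fixedProj_sq (U : H →ₗᵢ[ℝ] H) (v : H) {n : ℕ}
    (hn : n ≠ 0) :
    ‖birkhoffAverage ℝ U _root_.id n v - U.fixedProj v‖ ^ 2 =
      ‖birkhoffAverage ℝ U _root_.id n v‖ ^ 2 - ‖U.fixedProj v‖ ^ 2 := by
  rw [← U.fixedProj_birkhoffAverage v hn]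
  set w := birkhoffAverage ℝ U _root_.id n v
  have := Submodule.norm_sq_eq_add_norm_sq_starProjection w
    (U.toContinuousLinearMap.eqLocus (1 : H →L[ℝ] H))
  rw [Submodule.starProjection_orthogonal_val] at this
  rw [this]
  simp [fixedProj]

variable {X : Type*} [TopologicalSpace X] {U : X → H →ₗᵢ[ℝ] H}

theorem upperSemicontinuous_norm_fixedProj (hU : Continuous fun p : X × H => U p.1 p.2) (v : H) :
    UpperSemicontinuous fun x => ‖(U x).fixedProj v‖ := by
  intro x a ha
  have ht := ((U x).tendsto_birkhoffAverage_fixedProj v).norm.eventually_lt_const ha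
  obtain ⟨n, hn, hn0⟩ := (ht.and (eventually_ne_atTop 0)).exists
  filter_upwards [(continuous_birkhoffAverage_of_continuous hU n v).norm.continuousAt.eventually_lt
    continuousAt_const hn] with y hy
  rw [← (U y).fixedProj_birkhoffAverage v hn0]
  exact ((U y).norm_fixedProj_le _).trans_lt hy

/-- The squared error of the `n`-th average is the gap between two squared norms. Once small at `x`,
this gap stays small nearby for the same `n`, and that average is continuous in the parameter. -/
theorem continuousAt_fixedProj_of_norm (hU : Continuous fun p : X × H => U p.1 p.2) {v : H} {x : X}
    (hx : ContinuousAt (fun x => ‖(U x).fixedProj v‖) x) :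
    ContinuousAt (fun x => (U x).fixedProj v) x := by
  rw [Metric.continuousAt_iff']
  intro ε hε
  have hε3 : 0 < ε / 3 := by positivity
  have ht : Tendsto (fun n => ‖birkhoffAverage ℝ (U x) id n v‖ ^ 2 - ‖(U x).fixedProj v‖ ^ 2) atTop
      (𝓝 (‖(U x).fixedProj v‖ ^ 2 - ‖(U x).fixedProj v‖ ^ 2)) :=
    (((U x).tendsto_birkhoffAverage_fixedProj v).norm.pow 2).sub_const _
  rw [sub_self] at ht
  obtain ⟨n, hn, hn0⟩ := ((ht.eventually_lt_const (pow_pos hε3 2)).and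
    (eventually_ne_atTop 0)).exists
  have hA := (continuous_birkhoffAverage_of_continuous hU n v).continuousAt (x := x)
  have hd : ∀ y, ‖birkhoffAverage ℝ (U y) id n v‖ ^ 2 - ‖(U y).fixedProj v‖ ^ 2 < (ε / 3) ^ 2 →
      dist (birkhoffAverage ℝ (U y) id n v) ((U y).fixedProj v) < ε / 3 := by
    intro y hy
    rw [← (U y).norm_birkhoffAverage_sub_fixedProj_sq v hn0] at hy
    rw [dist_eq_norm]
    exact lt_of_pow_lt_pow_left₀ 2 hε3.le hy
  filter_upwards [((hA.norm.pow 2).sub (hx.pow 2)).eventually_lt continuousAt_const hn,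
    Metric.continuousAt_iff'.1 hA _ hε3] with y hy hy'
  have h1 := hd y hy
  have h2 := hd x hn
  rw [dist_comm] at h1
  have h3 := dist_triangle4 ((U y).fixedProj v) (birkhoffAverage ℝ (U y) id n v)
    (birkhoffAverage ℝ (U x) id n v) ((U x).fixedProj v)
  linarith

/-- For a strongly continuous family of linear isometries of a separable Hilbert space, the
projections onto the fixed vectors are strongly continuous at generic parameters. -/
theorem eventually_residual_continuousAt_fixedProj [TopologicalSpace.SeparableSpace H]
    (hU : Continuous fun p : X × H => U p.1 p.2) :
    ∀ᶠ x in residual X, ∀ v, ContinuousAt (fun y => (U y).fixedProj v) x := by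
  filter_upwards [eventually_countable_forall.2 fun i : ℕ =>
    (upperSemicontinuous_norm_fixedProj hU
      (TopologicalSpace.denseSeq H i)).eventually_residual_continuousAt] with x hx v
  rw [Metric.continuousAt_iff']
  intro ε hε
  obtain ⟨i, hi⟩ := (TopologicalSpace.denseRange_denseSeq H).exists_dist_lt v
    (show 0 < ε / 3 by positivity)
  set w := TopologicalSpace.denseSeq H i
  have hd : ∀ y, dist ((U y).fixedProj w) ((U y).fixedProj v) < ε / 3 := fun y => by
    rw [dist_eq_norm, ← map_sub]
    refine ((U y).norm_fixedProj_le _).trans_lt ?_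
    rwa [← dist_eq_norm, dist_comm]
  filter_upwards [Metric.continuousAt_iff'.1 (continuousAt_fixedProj_of_norm hU (hx i)) (ε / 3)
    (by positivity)] with y hy
  have h1 := hd y
  have h2 := hd x
  rw [dist_comm] at h1
  have h3 := dist_triangle4 ((U y).fixedProj v) ((U y).fixedProj w) ((U x).fixedProj w)
    ((U x).fixedProj v)
  linarith

end MeanErgodic

/-! ### Joint continuity of evaluation, and finiteness of the volume -/

theorem CrDiff.continuous_eval (d r : ℕ) {M : Type*} [TopologicalSpace M] [T2Space M]
    [CompactSpace M]
    [ChartedSpace (EuclideanSpace ℝ (Fin d)) M] [IsManifold (𝓡 d) ∞ M] :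
    Continuous fun p : CrDiff d r M × M => p.1 p.2 := by
  rcases Nat.eq_zero_or_pos r with rfl | hr
  · have hc : Continuous fun f : CrDiff d 0 M =>
        ((⟨f, f.continuous⟩, ⟨f.symm, f.symm.continuous⟩) : C(M, M) × C(M, M)) := by
      rw [continuous_iff_le_induced, crTopology, if_pos rfl]
    exact (hc.fst.comp continuous_fst).eval continuous_snd
  rw [continuous_iff_continuousAt]
  rintro ⟨f, x⟩ V hV
  rw [mem_map]
  obtain ⟨V, hVV, hVo, hxV⟩ := mem_nhds_iff.1 hV
  let φ := chartAt (EuclideanSpace ℝ (Fin d)) x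
  let ψ := chartAt (EuclideanSpace ℝ (Fin d)) (f x)
  have hN : φ.source ∩ f ⁻¹' (ψ.source ∩ V) ∈ 𝓝 x :=
    inter_mem (chart_source_mem_nhds _ x)
      (f.continuous.continuousAt (inter_mem (chart_source_mem_nhds _ _) (hVo.mem_nhds hxV)))
  obtain ⟨K, hKx, hKN, hK⟩ := local_compact_nhds hN
  have hfK : MapsTo f K (ψ.source ∩ V) := fun y hy => (hKN hy).2
  have hO : IsOpen (ψ '' (ψ.source ∩ V)) :=
    ψ.isOpen_image_of_subset_source (ψ.open_source.inter hVo) inter_subset_left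
  have hC : IsCompact (ψ '' (f '' K)) :=
    (hK.image f.continuous).image_of_continuousOn
      (ψ.continuousOn.mono (by rintro _ ⟨y, hy, rfl⟩; exact (hfK hy).1))
  -- With this `δ`, being `δ`-close to `f` in the chart, to order zero alone, keeps the image of `K`
  -- inside `V`.
  obtain ⟨δ, hδ, hδO⟩ := hC.exists_thickening_subset_open hO
    (image_mono (by rintro _ ⟨y, hy, rfl⟩; exact hfK hy))
  have hmem : crNhd f φ ψ K δ ∈ 𝓝 f := by
    refine IsOpen.mem_nhds ?_ ⟨fun y hy => (hfK hy).1, fun k _ y _ => by simpa using hδ⟩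
    have : crTopology d r M = TopologicalSpace.generateFrom _ := if_neg hr.ne'
    rw [this]
    exact TopologicalSpace.isOpen_generateFrom_of_mem ⟨f, φ, ψ, K, δ,
      IsManifold.chart_mem_maximalAtlas x, IsManifold.chart_mem_maximalAtlas (f x), hK,
      fun y hy => (hKN hy).1, fun y hy => (hfK hy).1, hδ, rfl⟩
  rw [nhds_prod_eq]
  filter_upwards [prod_mem_prod hmem hKx]
  rintro ⟨g, y⟩ ⟨⟨hgs, hg⟩, hy⟩
  apply hVV
  have hd : dist (ψ (g y)) (ψ (f y)) < δ := by
    have h0 := hg 0 (Nat.zero_le _) y hy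
    rw [← dist_eq_norm, iteratedFDeriv_zero_eq_comp, iteratedFDeriv_zero_eq_comp] at h0
    have h1 := (LinearIsometryEquiv.dist_map _ _ _).ge.trans_lt h0
    simpa [φ.left_inv (hKN hy).1] using h1
  obtain ⟨z, hz, hzg⟩ := hδO (Metric.mem_thickening_iff.2
    ⟨_, mem_image_of_mem _ (mem_image_of_mem _ hy), hd⟩)
  have hzy : z = g y := ψ.injOn hz.1 (hgs hy) hzg
  change g y ∈ V
  exact hzy ▸ hz.2

theorem IsSmoothVolume.isFiniteMeasure {d : ℕ} {M : Type*} [TopologicalSpace M] [T2Space M]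
    [CompactSpace M] [ChartedSpace (EuclideanSpace ℝ (Fin d)) M] [IsManifold (𝓡 d) ∞ M]
    [MeasurableSpace M] [BorelSpace M] {m : Measure M} (hm : IsSmoothVolume d m) :
    IsFiniteMeasure m := by
  have : IsLocallyFiniteMeasure m := by
    refine ⟨fun x => ?_⟩
    let φ := chartAt (EuclideanSpace ℝ (Fin d)) x
    obtain ⟨ρ, hρ, -, hρm⟩ := hm φ (IsManifold.chart_mem_maximalAtlas x)
    obtain ⟨K, hKx, hKs, hK⟩ := local_compact_nhds (chart_source_mem_nhds _ x : φ.source ∈ 𝓝 x)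
    refine ⟨K, hKx, ?_⟩
    rw [hρm K hK.measurableSet hKs]
    have hKi : IsCompact (φ '' K) := hK.image_of_continuousOn (φ.continuousOn.mono hKs)
    have hi : IntegrableOn ρ (φ '' K) :=
      (hρ.continuousOn.mono (image_subset_iff.2 fun y hy =>
        φ.map_source (hKs hy))).integrableOn_compact hKi
    exact hi.lintegral_lt_top
  exact ⟨isCompact_univ.measure_lt_top⟩

/-! ### Persistence of invariant sets -/

section Persistence

variable {X M : Type*} [TopologicalSpace X] [MetricSpace M] {F : X → M ≃ₜ M}

theorem isOpen_setOf_exists_iterate_mem (hF : Continuous fun p : X × M => F p.1 p.2) {O : Set M}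
    (hO : IsOpen O) : IsOpen {p : X × M | p.2 ∈ ⋃ n : ℕ, (F p.1)^[n] ⁻¹' O} := by
  have hn : ∀ n : ℕ, Continuous fun p : X × M => (F p.1)^[n] p.2 := by
    intro n
    induction n with
    | zero => exact continuous_snd
    | succ n ih =>
      simp only [Function.iterate_succ_apply']
      exact hF.comp (continuous_fst.prodMk ih)
  have : {p : X × M | p.2 ∈ ⋃ n : ℕ, (F p.1)^[n] ⁻¹' O} =
      ⋃ n : ℕ, (fun p : X × M => (F p.1)^[n] p.2) ⁻¹' O := by ext; simp
  rw [this]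
  exact isOpen_iUnion fun n => hO.preimage (hn n)

theorem eventually_subset_iUnion_preimage (hF : Continuous fun p : X × M => F p.1 p.2) {O : Set M}
    (hO : IsOpen O) {x : X} {C : Set M} (hC : IsCompact C)
    (hCO : C ⊆ ⋃ n : ℕ, (F x)^[n] ⁻¹' O) : ∀ᶠ y in 𝓝 x, C ⊆ ⋃ n : ℕ, (F y)^[n] ⁻¹' O :=
  hC.eventually_forall_of_forall_eventually fun _ hz =>
    (isOpen_setOf_exists_iterate_mem hF hO).mem_nhds (hCO hz)

theorem isOpen_iUnion_preimage_iterate (f : M ≃ₜ M) {O : Set M} (hO : IsOpen O) :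
    IsOpen (⋃ n : ℕ, f^[n] ⁻¹' O) :=
  isOpen_iUnion fun n => hO.preimage (f.continuous.iterate n)

variable [MeasurableSpace M] {m : Measure M}

/-- A fixed vector is invariant only almost everywhere; its superlevel set is modified on a null set
to become strictly invariant. -/
theorem exists_invariant_ae_eq_setOf_lt (f : M ≃ₜ M) (hf : MeasurePreserving f m m) {w : Lp ℝ 2 m}
    (hw : Lp.compMeasurePreservingₗᵢ ℝ f hf w = w) (a : ℝ) :
    ∃ t, MeasurableSet t ∧ f ⁻¹' t = t ∧ t =ᵐ[m] {x | a < w x} := by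
  have hs : MeasurableSet {x | a < w x} :=
    measurableSet_lt measurable_const (Lp.stronglyMeasurable w).measurable
  have hwf : (w : M → ℝ) =ᵐ[m] w ∘ f := by
    have := Lp.coeFn_compMeasurePreserving w hf
    rwa [show Lp.compMeasurePreserving f hf w = w from hw] at this
  obtain ⟨t, ht, hts, hft⟩ := hf.quasiMeasurePreserving.exists_preimage_eq_of_preimage_ae
    hs.nullMeasurableSet (by
      filter_upwards [hwf] with x hx
      change (a < w (f x)) = (a < w x)
      rw [hx, Function.comp_apply])
  exact ⟨t, ht, hft, hts⟩

variable [BorelSpace M] [IsFiniteMeasure m]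

/-- A forward invariant measurable set contains an invariant measurable set of full measure. -/
theorem exists_invariant_subset_of_subset_preimage (f : M ≃ₜ M) (hf : MeasurePreserving f m m)
    {E : Set M} (hE : MeasurableSet E) (hfE : E ⊆ f ⁻¹' E) :
    ∃ t, MeasurableSet t ∧ f ⁻¹' t = t ∧ t ⊆ E ∧ t =ᵐ[m] E := by
  have hfs : MeasurePreserving f.symm m m := hf.symm f.toMeasurableEquiv
  have hEs : f.symm ⁻¹' E ⊆ E := fun x hx => by simpa using hfE hx
  have hae : f.symm ⁻¹' E =ᵐ[m] E :=
    ae_eq_of_subset_of_measure_ge hEs (hfs.measure_preimage hE.nullMeasurableSet).ge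
      (hfs.measurable hE).nullMeasurableSet (measure_ne_top m E)
  -- The intersection of the forward images of `E`: they decrease and all have the same finite
  -- measure.
  refine ⟨⋂ n : ℕ, f.symm^[n] ⁻¹' E, .iInter fun n => (hfs.measurable.iterate n) hE, ?_,
    iInter_subset _ 0, ?_⟩
  · ext x
    simp only [mem_preimage, mem_iInter]
    refine ⟨fun h n => ?_, fun h n => ?_⟩
    · simpa [Function.iterate_succ_apply] using h (n + 1)
    · cases n with
      | zero => exact hfE (h 0)
      | succ n => simpa [Function.iterate_succ_apply] using h n
  · have := Filter.EventuallyEq.countable_iInter fun n : ℕ =>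
      hfs.quasiMeasurePreserving.preimage_iterate_ae_eq n hae
    rwa [iInter_const] at this

variable [CompactSpace M]

theorem exists_isCompact_lt_measureReal {O : Set M} (hO : IsOpen O) {a : ℝ} (ha : a < m.real O) :
    ∃ C ⊆ O, IsCompact C ∧ a < m.real C := by
  rcases lt_or_ge a 0 with h0 | h0
  · exact ⟨∅, empty_subset _, isCompact_empty, by simpa using h0⟩
  obtain ⟨C, hCO, hC, h⟩ := hO.exists_lt_isCompact
    ((ENNReal.ofReal_lt_iff_lt_toReal h0 (measure_ne_top m O)).2 ha)
  exact ⟨C, hCO, hC, (ENNReal.ofReal_lt_iff_lt_toReal h0 (measure_ne_top m C)).1 h⟩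

theorem upperSemicontinuous_neg_measureReal_iUnion (hF : Continuous fun p : X × M => F p.1 p.2)
    {O : Set M} (hO : IsOpen O) :
    UpperSemicontinuous fun x => -m.real (⋃ n : ℕ, (F x)^[n] ⁻¹' O) := by
  intro x a ha
  obtain ⟨C, hCO, hC, h⟩ := exists_isCompact_lt_measureReal
    (isOpen_iUnion_preimage_iterate (F x) hO) (neg_lt.1 ha)
  filter_upwards [eventually_subset_iUnion_preimage hF hO hC hCO] with y hy
  exact neg_lt.1 (h.trans_le (measureReal_mono hy))

/-- A compact set filling the saturation at `x` up to `ε / 2` stays inside the saturation at `y`,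
whose measure exceeds that at `x` by less than `ε / 2`. -/
theorem eventually_measureReal_diff_lt (hF : Continuous fun p : X × M => F p.1 p.2)
    {O : Set M} (hO : IsOpen O) {x : X}
    (hx : ContinuousAt (fun x => -m.real (⋃ n : ℕ, (F x)^[n] ⁻¹' O)) x) {ε : ℝ} (hε : 0 < ε) :
    ∀ᶠ y in 𝓝 x, m.real ((⋃ n : ℕ, (F y)^[n] ⁻¹' O) \ ⋃ n : ℕ, (F x)^[n] ⁻¹' O) < ε := by
  obtain ⟨C, hCO, hC, h⟩ := exists_isCompact_lt_measureReal (m := m)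
    (isOpen_iUnion_preimage_iterate (F x) hO) (sub_lt_self _ (half_pos hε))
  filter_upwards [eventually_subset_iUnion_preimage hF hO hC hCO,
    hx.eventually_const_lt (sub_lt_self _ (half_pos hε))] with y hy hy'
  refine (measureReal_mono (sdiff_subset_sdiff_right hCO)).trans_lt ?_
  rw [measureReal_sdiff hy hC.measurableSet]
  linarith

/-- Invariant sets persist in measure at generic parameters. -/
theorem eventually_residual_exists_invariant (hF : Continuous fun p : X × M => F p.1 p.2)
    (hm : ∀ x, MeasurePreserving (F x) m m) :
    ∀ᶠ x in residual X, ∀ Λ : Set M, MeasurableSet Λ → F x ⁻¹' Λ = Λ → ∀ ε : ENNReal, 0 < ε →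
      ∀ᶠ y in 𝓝 x, ∃ t, MeasurableSet t ∧ F y ⁻¹' t = t ∧ m (symmDiff t Λ) < ε := by
  let U : X → Lp ℝ 2 m →ₗᵢ[ℝ] Lp ℝ 2 m := fun x => Lp.compMeasurePreservingₗᵢ ℝ (F x) (hm x)
  let G : X → C(M, M) := fun x => ⟨F x, (F x).continuous⟩
  have hG : Continuous G := ContinuousMap.continuous_of_continuous_uncurry _ hF
  have hU : Continuous fun p : X × Lp ℝ 2 m => U p.1 p.2 :=
    Continuous.compMeasurePreservingLp (g := fun p : X × Lp ℝ 2 m => G p.1) continuous_snd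
      (hG.comp continuous_fst) (fun p => hm p.1) ENNReal.ofNat_ne_top
  have : Fact ((2 : ENNReal) ≠ ⊤) := ⟨ENNReal.ofNat_ne_top⟩
  filter_upwards [eventually_residual_continuousAt_fixedProj hU] with x hx Λ hΛ hfΛ ε hε
  let v : Lp ℝ 2 m := indicatorConstLp 2 hΛ (measure_ne_top m Λ) 1
  have hv : U x v = v := by
    refine Lp.ext ((Lp.coeFn_compMeasurePreserving v (hm x)).trans ?_)
    have h1 : (v : M → ℝ) =ᵐ[m] Λ.indicator fun _ => 1 := indicatorConstLp_coeFn
    refine ((hm x).quasiMeasurePreserving.ae_eq_comp h1).trans (EventuallyEq.trans ?_ h1.symm)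
    refine Eventually.of_forall fun z => ?_
    conv_rhs => rw [← hfΛ]
    rfl
  have hlim : Tendsto (fun y => (U y).fixedProj v) (𝓝 x) (𝓝 v) := by
    have := hx v
    rwa [ContinuousAt, (U x).fixedProj_of_fixed hv] at this
  have hmeas := tendstoInMeasure_of_tendsto_Lp hlim (ENNReal.ofReal (1 / 2)) (by simp)
  -- An indicator takes only the values 0 and 1, so at almost every point where `t` and `Λ` differ
  -- the projection is off by at least `1 / 2`.
  filter_upwards [hmeas.eventually_lt_const hε] with y hy
  obtain ⟨t, ht, hft, hts⟩ := exists_invariant_ae_eq_setOf_lt (F y) (hm y)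
    ((U y).map_fixedProj v) (1 / 2)
  refine ⟨t, ht, hft, (measure_mono_ae ?_).trans_lt hy⟩
  filter_upwards [hts, indicatorConstLp_coeFn (p := 2) (hs := hΛ) (hμs := measure_ne_top m Λ)
    (c := (1 : ℝ))] with z hz hvz hzt
  change ENNReal.ofReal (1 / 2) ≤ edist ((U y).fixedProj v z) (v z)
  rw [edist_dist, Real.dist_eq, hvz]
  refine ENNReal.ofReal_le_ofReal ?_
  have hz' : z ∈ t ↔ 1 / 2 < (U y).fixedProj v z := iff_of_eq hz
  rcases hzt with ⟨h1, h2⟩ | ⟨h1, h2⟩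
  · rw [indicator_of_notMem h2, le_abs]
    left
    linarith [hz'.1 h1]
  · rw [indicator_of_mem h1, le_abs]
    right
    linarith [not_lt.1 (mt hz'.2 h2)]

/-- For a continuous family of measure preserving homeomorphisms of a compact metric space, at
generic parameters invariant sets persist both in measure and in the Hausdorff sense. -/
theorem eventually_residual_exists_invariant_subset_thickening
    (hF : Continuous fun p : X × M => F p.1 p.2) (hm : ∀ x, MeasurePreserving (F x) m m) :
    ∀ᶠ x in residual X, ∀ Λ : Set M, MeasurableSet Λ → F x ⁻¹' Λ = Λ → ∀ η : ℝ, 0 < η →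
      ∀ᶠ y in 𝓝 x, ∃ t, MeasurableSet t ∧ F y ⁻¹' t = t ∧ t ⊆ Metric.thickening η Λ ∧
        m (symmDiff t Λ) < ENNReal.ofReal η := by
  obtain ⟨B, hBc, -, hB⟩ := TopologicalSpace.exists_countable_basis M
  -- Countability lets one residual set serve every `O`, which is chosen only after `Λ` and `η`.
  have hBf : {S : Set (Set M) | S.Finite ∧ S ⊆ B}.Countable :=
    countable_ofPred_finite_subset hBc
  have hopen : ∀ S : Set (Set M), S.Finite ∧ S ⊆ B → IsOpen (⋃₀ S) := fun S hS =>
    isOpen_sUnion fun s hs => hB.isOpen (hS.2 hs)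
  have hres : ∀ᶠ x in residual X, ∀ S ∈ {S : Set (Set M) | S.Finite ∧ S ⊆ B},
      ContinuousAt (fun x => -m.real (⋃ n : ℕ, (F x)^[n] ⁻¹' (⋃₀ S))) x :=
    (eventually_countable_ball hBf).2 fun S hS =>
      (upperSemicontinuous_neg_measureReal_iUnion hF
        (hopen S hS)).eventually_residual_continuousAt
  filter_upwards [hres, eventually_residual_exists_invariant hF hm] with x hxS hxm Λ hΛ hfΛ η hη
  obtain ⟨S, hS, hηS, hSΛ⟩ : ∃ S : Set (Set M), (S.Finite ∧ S ⊆ B) ∧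
      (Metric.thickening η Λ)ᶜ ⊆ ⋃₀ S ∧ ⋃₀ S ⊆ (closure Λ)ᶜ := by
    have hK : IsCompact (Metric.thickening η Λ)ᶜ :=
      Metric.isOpen_thickening.isClosed_compl.isCompact
    obtain ⟨T, hT, hTf, hKT⟩ := hK.elim_finite_subcover_image
      (b := {s | s ∈ B ∧ s ⊆ (closure Λ)ᶜ}) (c := id) (fun s hs => hB.isOpen hs.1) (by
        intro z hz
        obtain ⟨s, hs, hzs, hsΛ⟩ := hB.exists_subset_of_mem_open
          (show z ∈ (closure Λ)ᶜ from fun h => hz (Metric.closure_subset_thickening hη Λ h))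
          isClosed_closure.isOpen_compl
        exact mem_biUnion (show s ∈ {s | s ∈ B ∧ s ⊆ (closure Λ)ᶜ} from ⟨hs, hsΛ⟩) hzs)
    refine ⟨T, ⟨hTf, fun s hs => (hT hs).1⟩, ?_, sUnion_subset fun s hs => (hT hs).2⟩
    rwa [sUnion_eq_biUnion]
  set O := ⋃₀ S with hO
  have hOo : IsOpen O := hopen S hS
  have hdisj : Disjoint Λ (⋃ n : ℕ, (F x)^[n] ⁻¹' O) := by
    rw [Set.disjoint_iUnion_right]
    intro n
    rw [Set.disjoint_left]
    intro z hz hzO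
    refine hSΛ hzO (subset_closure ?_)
    rwa [← mem_preimage, Set.preimage_iterate_eq, Function.IsFixedPt.iterate hfΛ n]
  have hη2 : 0 < η / 2 := half_pos hη
  filter_upwards [eventually_measureReal_diff_lt hF hOo (hxS S hS) hη2,
    hxm Λ hΛ hfΛ (ENNReal.ofReal (η / 2)) (by simpa using hη)] with y hy hy'
  obtain ⟨t, ht, hft, htΛ⟩ := hy'
  set W := ⋃ n : ℕ, (F y)^[n] ⁻¹' O with hW
  have hWm : MeasurableSet W := (isOpen_iUnion_preimage_iterate (F y) hOo).measurableSet
  have hWf : F y ⁻¹' W ⊆ W := by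
    intro z hz
    obtain ⟨n, hn⟩ := mem_iUnion.1 hz
    exact mem_iUnion.2 ⟨n + 1, hn⟩
  obtain ⟨t', ht', hft', htt', hae⟩ := exists_invariant_subset_of_subset_preimage (F y) (hm y)
    (ht.diff hWm) (fun z hz => ⟨hft.ge hz.1, fun h => hz.2 (hWf h)⟩)
  refine ⟨t', ht', hft', fun z hz => ?_, ?_⟩
  · by_contra h
    exact (htt' hz).2 (mem_iUnion.2 ⟨0, hηS h⟩)
  · rw [measure_congr (hae.symmDiff (ae_eq_refl Λ))]
    -- A point of `Λ` lost by removing `W` lies outside the saturation of `O` under `F x`, which is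
    -- disjoint from `Λ`.
    have hsub : symmDiff (t \ W) Λ ⊆ symmDiff t Λ ∪ (W \ ⋃ n : ℕ, (F x)^[n] ⁻¹' O) := by
      rintro z (⟨h1, h2⟩ | ⟨h1, h2⟩)
      · exact Or.inl (Or.inl ⟨h1.1, h2⟩)
      · by_cases hzt : z ∈ t
        · exact Or.inr ⟨by_contra fun h => h2 ⟨hzt, h⟩, Set.disjoint_left.1 hdisj h1⟩
        · exact Or.inl (Or.inr ⟨h1, hzt⟩)
    calc m (symmDiff (t \ W) Λ) ≤ _ := (measure_mono hsub).trans (measure_union_le _ _)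
      _ < ENNReal.ofReal (η / 2) + ENNReal.ofReal (η / 2) :=
        ENNReal.add_lt_add htΛ ((ENNReal.lt_ofReal_iff_toReal_lt (measure_ne_top _ _)).2 hy)
      _ = ENNReal.ofReal η := by rw [← ENNReal.ofReal_add hη2.le hη2.le, add_halves]

end Persistence

theorem theoremt (d r : ℕ) (hd : 2 ≤ d) {M : Type*} [MetricSpace M] [CompactSpace M]
    [ConnectedSpace M] [ChartedSpace (EuclideanSpace ℝ (Fin d)) M] [IsManifold (𝓡 d) ∞ M]
    [MeasurableSpace M] [BorelSpace M] (m : Measure M) (hm : IsSmoothVolume d m) :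
    ∃ R ∈ residual (VolDiff d r m), ∀ f ∈ R,
      ∀ Λ : Set M, MeasurableSet Λ → f.1 ⁻¹' Λ = Λ → ∀ η : ℝ, 0 < η →
        ∀ᶠ g : VolDiff d r m in 𝓝 f,
          ∃ Λ' : Set M, MeasurableSet Λ' ∧ g.1 ⁻¹' Λ' = Λ' ∧
            Λ' ⊆ Metric.thickening η Λ ∧ m (symmDiff Λ' Λ) < ENNReal.ofReal η := by
  have := hm.isFiniteMeasure
  have hF : Continuous fun p : VolDiff d r m × M => p.1.1.toHomeomorph p.2 :=
    (CrDiff.continuous_eval d r).comp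
      ((continuous_subtype_val.comp continuous_fst).prodMk continuous_snd)
  exact ⟨_, eventually_residual_exists_invariant_subset_thickening hF
    (m := m) (F := fun g : VolDiff d r m => g.1.toHomeomorph) fun g => g.2,
    fun f hf => hf⟩
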